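/- Let $\mathcal H_a,\mathcal H_b$ be finite-dimensional complex Hilbert spaces. For density matrices $\rho,\sigma$ on the same space let $F(\rho,\sigma)=\operatorname{tr}\sqrt{\sqrt{\sigma}\,\rho\,\sqrt{\sigma}}$ and let $d_B(\rho,\sigma)=\sqrt{2-2F(\rho,\sigma)}$ be the Bures distance. A state on $\mathcal H_a\otimes\mathcal H_b$ is separable ($\sigma\in\mathcal S$) if $\sigma=\sum_i p_i\,\rho_a^i\otimes\rho_b^i$ (a finite sum) with probabilities $p_i$ and density matrices $\rho_a^i,\rho_b^i$, and classical-quantum ($\sigma\in\mathcal{CQ}$) if $\sigma=\sum_i p_i\,|e_i\rangle\langle e_i|\otimes\rho_b^i$ with probabilities $p_i$, orthonormal vectors $e_i$ of the first factor and density matrices $\rho_b^i$. The Bures distance of entanglement and the Bures distance of (asymmetric) discord of a bipartite state are $$E_B(\rho_{ab})=\min_{\sigma\in\mathcal S}d_B^2(\rho_{ab},\sigma),\qquad \hat D_B(\rho_{ab})=\min_{\sigma\in\mathcal{CQ}}d_B^2(\rho_{ab},\sigma).$$ The minimal Bures distance of discord over state extensions is $$\hat{\mathcal E}_B(\rho_{ab})=\min_{\operatorname{tr}_{a'}[\rho_{aa'b}]=\rho_{ab}}\hat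 D_B(\rho_{aa'b}),$$ where the minimum is over all finite-dimensional ancilla spaces $\mathcal H_{a'}$ and all density matrices $\rho_{aa'b}$ on $\mathcal H_a\otimes\mathcal H_{a'}\otimes\mathcal H_b$ with $\operatorname{tr}_{a'}\rho_{aa'b}=\rho_{ab}$, and $\hat D_B$ is taken across the cut $aa':b$ (with $aa'$ as the first, classical, factor). Then for every density matrix $\rho_{ab}$ on $\mathcal H_a\otimes\mathcal H_b$ these minima are attained (the one defining $\hat D_B$, for every extension $\rho_{aa'b}$), and $$\hat{\mathcal E}_B(\rho_{ab})=E_B(\rho_{ab}).$$ -/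

import Mathlib

open scoped Matrix Kronecker ComplexOrder MatrixOrder

noncomputable section

namespace QState

/-- `ρ` is a density matrix on `ℂ^ι`: positive semidefinite with unit trace. -/
def IsDensity {ι : Type*} [Fintype ι] (ρ : Matrix ι ι ℂ) : Prop :=
  ρ.PosSemidef ∧ ρ.trace = 1

/-- The rank-one operator `|v⟩⟨v|`. -/
def ketbra {ι : Type*} (v : EuclideanSpace ℂ ι) : Matrix ι ι ℂ :=
  Matrix.of fun i j => v i * star (v j)

/-- The (square-root) fidelity `F(ρ, σ) = tr √(√σ ρ √σ)`. -/
def fidelity {ι : Type*} [Fintype ι] [DecidableEq ι] (ρ σ : Matrix ι ι ℂ) : ℝ :=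
  (Matrix.trace (CFC.sqrt (CFC.sqrt σ * ρ * CFC.sqrt σ))).re

/-- The Bures distance `d_B(ρ, σ) = √(2 - 2 F(ρ, σ))`. -/
def buresDist {ι : Type*} [Fintype ι] [DecidableEq ι] (ρ σ : Matrix ι ι ℂ) : ℝ :=
  Real.sqrt (2 - 2 * fidelity ρ σ)

/-- The separable states on `ℂ^α ⊗ ℂ^β`: finite convex mixtures of product states. -/
def separable (α β : Type*) [Fintype α] [Fintype β] : Set (Matrix (α × β) (α × β) ℂ) :=
  {σ | ∃ (k : ℕ) (p : Fin k → ℝ) (ρa : Fin k → Matrix α α ℂ) (ρb : Fin k → Matrix β β ℂ),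
    (∀ i, 0 ≤ p i) ∧ ∑ i, p i = 1 ∧ (∀ i, IsDensity (ρa i)) ∧ (∀ i, IsDensity (ρb i)) ∧
    σ = ∑ i, (p i : ℂ) • (ρa i ⊗ₖ ρb i)}

/-- The classical-quantum states on `ℂ^α ⊗ ℂ^β` (classical on the first factor):
`∑ᵢ pᵢ |eᵢ⟩⟨eᵢ| ⊗ ρᵢ` with `(eᵢ)` orthonormal in `ℂ^α`. -/
def classicalQuantum (α β : Type*) [Fintype α] [Fintype β] :
    Set (Matrix (α × β) (α × β) ℂ) :=
  {σ | ∃ (k : ℕ) (p : Fin k → ℝ) (e : Fin k → EuclideanSpace ℂ α) (ρb : Fin k → Matrix β β ℂ),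
    (∀ i, 0 ≤ p i) ∧ ∑ i, p i = 1 ∧ Orthonormal ℂ e ∧ (∀ i, IsDensity (ρb i)) ∧
    σ = ∑ i, (p i : ℂ) • (ketbra (e i) ⊗ₖ ρb i)}

/-- The values `d_B(ρ, σ)²`, for `σ` in a set `S` of states. -/
def sqBuresValues {ι : Type*} [Fintype ι] [DecidableEq ι] (ρ : Matrix ι ι ℂ)
    (S : Set (Matrix ι ι ℂ)) : Set ℝ :=
  {x | ∃ σ ∈ S, x = buresDist ρ σ ^ 2}

/-- The Bures distance of entanglement `E_B`. -/
def buresEntanglement {α β : Type*} [Fintype α] [Fintype β] [DecidableEq α] [DecidableEq β]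
    (ρ : Matrix (α × β) (α × β) ℂ) : ℝ :=
  sInf (sqBuresValues ρ (separable α β))

/-- The Bures distance of (asymmetric) discord, with the first factor as the classical one. -/
def buresDiscord {α β : Type*} [Fintype α] [Fintype β] [DecidableEq α] [DecidableEq β]
    (ρ : Matrix (α × β) (α × β) ℂ) : ℝ :=
  sInf (sqBuresValues ρ (classicalQuantum α β))

/-- The partial trace over the ancilla `a'` (index type `γ`) of an operator on `(a a') b`. -/
def traceAncilla {α γ β : Type*} [Fintype γ]
    (τ : Matrix ((α × γ) × β) ((α × γ) × β) ℂ) : Matrix (α × β) (α × β) ℂ :=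
  Matrix.of fun x y => ∑ m, τ ((x.1, m), x.2) ((y.1, m), y.2)

/-- `τ` is a state extension of `ρ` by an ancilla `a'` on the first side. -/
def IsExtension {α γ β : Type*} [Fintype α] [Fintype γ] [Fintype β]
    (ρ : Matrix (α × β) (α × β) ℂ) (τ : Matrix ((α × γ) × β) ((α × γ) × β) ℂ) : Prop :=
  IsDensity τ ∧ traceAncilla τ = ρ

/-- The values of the Bures discord, across the cut `a a' : b`, at the state extensions of `ρ`
by an ancilla `ℂ^n` of arbitrary finite dimension `n`. -/
def extensionDiscordValues {α β : Type*} [Fintype α] [Fintype β] [DecidableEq α] [DecidableEq β]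
    (ρ : Matrix (α × β) (α × β) ℂ) : Set ℝ :=
  {x | ∃ (n : ℕ) (τ : Matrix ((α × Fin n) × β) ((α × Fin n) × β) ℂ),
    IsExtension ρ τ ∧ x = buresDiscord τ}

/-- The minimal Bures distance of discord over state extensions, `Ê_B`. -/
def minExtensionDiscord {α β : Type*} [Fintype α] [Fintype β] [DecidableEq α] [DecidableEq β]
    (ρ : Matrix (α × β) (α × β) ℂ) : ℝ :=
  sInf (extensionDiscordValues ρ)

end QState

end

namespace QState

/-! A matrix `A` with `A * Aᴴ = ρ` is a purification of `ρ` whose environment is the column index,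
and the overlap of two purifications is `tr (Aᴴ * B)`. Uhlmann's theorem (`re_trace_le_fidelity`,
`exists_purification`) makes the fidelity the largest real part of such an overlap. Tracing out the
ancilla only hands it over to the environment, so a purification of an extension also purifies the
original state.

Lower bound: tracing out `a'` does not decrease the fidelity (`fidelity_le_traceAncilla`) and sends
classical-quantum states to separable ones, so no extension has discord below `E_B`.

Upper bound: split the closest separable state into products with pure first factors and tag each
term with its own ancilla level. The result is a classical-quantum extension `υ`
(`exists_classicalQuantum_extension`), and Uhlmann's theorem extends `ρ` to some `τ` at least as
close to `υ` (`exists_isExtension`).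

Compactness of both sets of states gives the minima for `E_B` and for the discord; the minimum over
extensions is attained at the `τ` just described. -/

/-! ### Polar decomposition and Uhlmann's theorem -/

/-- Two matrices with the same Gram matrix differ by a unitary on the left. -/
theorem exists_unitary_mul_eq {κ ι : Type*} [Fintype κ] [DecidableEq κ] [Fintype ι] [DecidableEq ι]
    {A B : Matrix κ ι ℂ} (h : Aᴴ * A = Bᴴ * B) :
    ∃ U : Matrix κ κ ℂ, Uᴴ * U = 1 ∧ U * Uᴴ = 1 ∧ A = U * B := by
  set fA := Matrix.toEuclideanLin A with hfA
  set fB := Matrix.toEuclideanLin B with hfB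
  have gram : ∀ (C : Matrix κ ι ℂ) (x : EuclideanSpace ℂ ι),
      inner ℂ (Matrix.toEuclideanLin C x) (Matrix.toEuclideanLin C x) =
        (star x.ofLp) ⬝ᵥ ((Cᴴ * C) *ᵥ x.ofLp) := by
    intro C x
    rw [EuclideanSpace.inner_eq_star_dotProduct, dotProduct_comm, Matrix.ofLp_toLpLin, Matrix.toLin'_apply,
      Matrix.star_mulVec, ← Matrix.dotProduct_mulVec, Matrix.mulVec_mulVec]
  have hnorm : ∀ x, ‖fA x‖ = ‖fB x‖ := by
    intro x
    have : inner ℂ (fA x) (fA x) = inner ℂ (fB x) (fB x) := by rw [hfA, hfB, gram, gram, h]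
    rw [inner_self_eq_norm_sq_to_K, inner_self_eq_norm_sq_to_K] at this
    have h2 : ‖fA x‖ ^ 2 = ‖fB x‖ ^ 2 := by exact_mod_cast this
    exact (sq_eq_sq₀ (norm_nonneg _) (norm_nonneg _)).1 h2
  have hker : LinearMap.ker fB ≤ LinearMap.ker fA := by
    intro x hx
    rw [LinearMap.mem_ker] at hx ⊢
    rw [← norm_eq_zero, hnorm, hx, norm_zero]
  -- Equal norms make `B x ↦ A x` a well-defined isometry on the range of `B`; by finite dimension
  -- it extends to the whole space.
  let l : LinearMap.range fB →ₗ[ℂ] EuclideanSpace ℂ κ :=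
    (LinearMap.ker fB).liftQ fA hker ∘ₗ fB.quotKerEquivRange.symm.toLinearMap
  have hl : ∀ x, l ⟨fB x, LinearMap.mem_range_self fB x⟩ = fA x := by
    intro x
    have : fB.quotKerEquivRange.symm ⟨fB x, LinearMap.mem_range_self fB x⟩ =
        (LinearMap.ker fB).mkQ x := fB.quotKerEquivRange_symm_apply_image x _
    simp only [l, LinearMap.comp_apply, LinearEquiv.coe_coe, this]
    simp
  let L : LinearMap.range fB →ₗᵢ[ℂ] EuclideanSpace ℂ κ :=
    ⟨l, by
      rintro ⟨_, x, rfl⟩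
      rw [hl, hnorm]; rfl⟩
  let V := L.extend
  have hV : ∀ x, V (fB x) = fA x := fun x =>
    (L.extend_apply ⟨fB x, LinearMap.mem_range_self fB x⟩).trans (hl x)
  obtain ⟨U, hU⟩ : ∃ U : Matrix κ κ ℂ, Matrix.toEuclideanLin U = V.toLinearMap :=
    ⟨Matrix.toEuclideanLin.symm V.toLinearMap, LinearEquiv.apply_symm_apply _ _⟩
  have hUU : Uᴴ * U = 1 := by
    ext i j
    have h1 : inner ℂ (V (EuclideanSpace.single i 1)) (V (EuclideanSpace.single j 1)) =
      inner ℂ (EuclideanSpace.single i (1 : ℂ)) (EuclideanSpace.single j (1 : ℂ)) :=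
      V.inner_map_map _ _
    have h2 : ∀ i k, V (EuclideanSpace.single i 1) k = U k i := by
      intro i k
      have : V (EuclideanSpace.single i 1) = Matrix.toEuclideanLin U (EuclideanSpace.single i 1) := by
        rw [hU]; rfl
      rw [this, Matrix.ofLp_toLpLin, Matrix.toLin'_apply]
      simp
    rw [PiLp.inner_apply] at h1
    simp only [h2] at h1
    rw [Matrix.mul_apply]
    simp only [Matrix.conjTranspose_apply]
    have h3 : inner ℂ (EuclideanSpace.single i (1 : ℂ)) (EuclideanSpace.single j (1 : ℂ)) =
      (1 : Matrix κ κ ℂ) i j := by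
      simp [EuclideanSpace.inner_single_left, Matrix.one_apply]
    rw [h3] at h1
    rw [← h1]
    exact Finset.sum_congr rfl fun k _ => mul_comm _ _
  refine ⟨U, hUU, mul_eq_one_comm.1 hUU, ?_⟩
  apply Matrix.toEuclideanLin.injective
  ext1 x
  rw [← hfA, ← hV x]
  have : Matrix.toEuclideanLin (U * B) x = Matrix.toEuclideanLin U (fB x) := by
    apply (WithLp.equiv 2 _).injective
    ext k
    simp [hfB, Matrix.toLpLin_apply]
  rw [this, hU]; rfl

theorem sqrt_mul_self_eq {ι : Type*} [Fintype ι] [DecidableEq ι] {ρ : Matrix ι ι ℂ}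
    (h : ρ.PosSemidef) : CFC.sqrt ρ * CFC.sqrt ρ = ρ :=
  CFC.sqrt_mul_sqrt_self ρ h.nonneg

theorem conjTranspose_sqrt {ι : Type*} [Fintype ι] [DecidableEq ι] (ρ : Matrix ι ι ℂ) :
    (CFC.sqrt ρ)ᴴ = CFC.sqrt ρ :=
  (Matrix.nonneg_iff_posSemidef.1 (CFC.sqrt_nonneg ρ)).isHermitian

/-- Polar decomposition of `√ρ √σ`, expressed through the operator whose trace is the fidelity. -/
theorem exists_polar {ι : Type*} [Fintype ι] [DecidableEq ι] {ρ : Matrix ι ι ℂ}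
    (hρ : ρ.PosSemidef) (σ : Matrix ι ι ℂ) :
    ∃ U : Matrix ι ι ℂ, Uᴴ * U = 1 ∧ U * Uᴴ = 1 ∧
      CFC.sqrt ρ * CFC.sqrt σ = U * CFC.sqrt (CFC.sqrt σ * ρ * CFC.sqrt σ) := by
  apply exists_unitary_mul_eq
  rw [Matrix.conjTranspose_mul, conjTranspose_sqrt, conjTranspose_sqrt, conjTranspose_sqrt,
    sqrt_mul_self_eq, Matrix.mul_assoc, ← Matrix.mul_assoc (CFC.sqrt ρ), sqrt_mul_self_eq hρ,
    Matrix.mul_assoc]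
  have := hρ.conjTranspose_mul_mul_same (CFC.sqrt σ)
  rwa [conjTranspose_sqrt] at this

/-- `2 Re tr(X† Y) ≤ tr(X† X) + tr(Y† Y)`. -/
theorem two_mul_re_trace_conjTranspose_mul_le {κ ι : Type*} [Fintype κ] [Fintype ι]
    (X Y : Matrix κ ι ℂ) :
    2 * (Matrix.trace (Xᴴ * Y)).re ≤ (Matrix.trace (Xᴴ * X)).re + (Matrix.trace (Yᴴ * Y)).re := by
  have h := (Matrix.posSemidef_conjTranspose_mul_self (X - Y)).trace_nonneg
  have h1 := (Complex.le_def.1 h).1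
  have h2 : (Matrix.trace (Yᴴ * X)).re = (Matrix.trace (Xᴴ * Y)).re := by
    have : Yᴴ * X = (Xᴴ * Y)ᴴ := by simp
    rw [this, Matrix.trace_conjTranspose]; simp
  simp only [Matrix.conjTranspose_sub, Matrix.sub_mul, Matrix.mul_sub, Matrix.trace_sub,
    Complex.sub_re, Complex.zero_re] at h1
  linarith

/-- A purification is obtained from the canonical one `√ρ` by a coisometry `J`, up to a
unitary. -/
theorem exists_eq_sqrt_mul {ι κ : Type*} [Fintype ι] [DecidableEq ι] [Fintype κ] [DecidableEq κ]
    {J : Matrix ι κ ℂ} (hJ : J * Jᴴ = 1) (A : Matrix ι κ ℂ) :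
    ∃ V : Matrix κ κ ℂ, Vᴴ * V = 1 ∧ V * Vᴴ = 1 ∧ A = CFC.sqrt (A * Aᴴ) * J * V := by
  have hA := Matrix.posSemidef_self_mul_conjTranspose A
  obtain ⟨U, h1, h2, h3⟩ := exists_unitary_mul_eq (A := Aᴴ) (B := (CFC.sqrt (A * Aᴴ) * J)ᴴ) (by
    rw [Matrix.conjTranspose_conjTranspose, Matrix.conjTranspose_conjTranspose,
      Matrix.conjTranspose_mul, conjTranspose_sqrt, Matrix.mul_assoc, ← Matrix.mul_assoc J, hJ,
      Matrix.one_mul, sqrt_mul_self_eq hA])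
  refine ⟨Uᴴ, by simpa using h2, by simpa using h1, ?_⟩
  have := congrArg Matrix.conjTranspose h3
  rwa [Matrix.conjTranspose_mul, Matrix.conjTranspose_conjTranspose,
    Matrix.conjTranspose_conjTranspose] at this

/-- Uhlmann's bound: the overlap of two purifications is at most the fidelity. -/
theorem re_trace_le_fidelity {ι κ : Type*} [Fintype ι] [DecidableEq ι] [Fintype κ] [DecidableEq κ]
    {J : Matrix ι κ ℂ} (hJ : J * Jᴴ = 1) (A B : Matrix ι κ ℂ) :
    (Matrix.trace (Aᴴ * B)).re ≤ fidelity (A * Aᴴ) (B * Bᴴ) := by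
  obtain ⟨V, hV, hV', hA⟩ := exists_eq_sqrt_mul hJ A
  obtain ⟨W, hW, hW', hB⟩ := exists_eq_sqrt_mul hJ B
  have hρ := Matrix.posSemidef_self_mul_conjTranspose A
  obtain ⟨U, hU, hU', hP⟩ := exists_polar hρ (B * Bᴴ)
  set r := CFC.sqrt (A * Aᴴ) with hr
  set s := CFC.sqrt (B * Bᴴ) with hs
  set P := CFC.sqrt (s * (A * Aᴴ) * s) with hPdef
  have hP0 : P.PosSemidef := Matrix.nonneg_iff_posSemidef.1 (CFC.sqrt_nonneg _)
  set S := CFC.sqrt P with hS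
  have hSS : S * S = P := sqrt_mul_self_eq hP0
  have hSh : Sᴴ = S := conjTranspose_sqrt P
  have hrh : rᴴ = r := conjTranspose_sqrt _
  -- Splitting `P = S * S` evenly between the two factors gives each of them squared norm `tr P`,
  -- which is the fidelity.
  have key := two_mul_re_trace_conjTranspose_mul_le (S * Uᴴ * J) (S * J * (W * Vᴴ))
  have e1 : Matrix.trace ((S * Uᴴ * J)ᴴ * (S * J * (W * Vᴴ))) = Matrix.trace (Aᴴ * B) := by
    have : Aᴴ * B = Vᴴ * (Jᴴ * (r * s) * J * W) := by
      conv_lhs => rw [hA, hB]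
      simp only [Matrix.conjTranspose_mul, hrh, Matrix.mul_assoc]
    rw [this, Matrix.trace_mul_comm Vᴴ, hP, ← hSS]
    simp only [Matrix.conjTranspose_mul, hSh, Matrix.mul_assoc, Matrix.conjTranspose_conjTranspose]
  have e2 : Matrix.trace ((S * Uᴴ * J)ᴴ * (S * Uᴴ * J)) = Matrix.trace P := by
    rw [Matrix.trace_mul_comm, Matrix.conjTranspose_mul, Matrix.conjTranspose_mul,
      Matrix.conjTranspose_conjTranspose, hSh, Matrix.mul_assoc, ← Matrix.mul_assoc J, hJ,
      Matrix.one_mul, Matrix.mul_assoc, ← Matrix.mul_assoc Uᴴ, hU, Matrix.one_mul, hSS]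
  have e3 : Matrix.trace ((S * J * (W * Vᴴ))ᴴ * (S * J * (W * Vᴴ))) = Matrix.trace P := by
    rw [Matrix.trace_mul_comm, Matrix.conjTranspose_mul (S * J), Matrix.mul_assoc,
      ← Matrix.mul_assoc (W * Vᴴ), Matrix.conjTranspose_mul W, Matrix.conjTranspose_conjTranspose,
      Matrix.mul_assoc W, ← Matrix.mul_assoc Vᴴ, hV, Matrix.one_mul, hW', Matrix.one_mul,
      Matrix.conjTranspose_mul, hSh, Matrix.mul_assoc, ← Matrix.mul_assoc J, hJ,
      Matrix.one_mul, hSS]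
  rw [e1, e2, e3] at key
  change _ ≤ (Matrix.trace P).re
  linarith

/-- Uhlmann's theorem: given a purification of `σ` with a large enough environment, some
purification of `ρ` has an overlap with it equal to the fidelity. -/
theorem exists_purification {ι κ : Type*} [Fintype ι] [DecidableEq ι] [Fintype κ] [DecidableEq κ]
    {J : Matrix ι κ ℂ} (hJ : J * Jᴴ = 1) {ρ : Matrix ι ι ℂ} (hρ : ρ.PosSemidef)
    (B : Matrix ι κ ℂ) :
    ∃ A : Matrix ι κ ℂ, A * Aᴴ = ρ ∧ (Matrix.trace (Aᴴ * B)).re = fidelity ρ (B * Bᴴ) := by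
  obtain ⟨W, hW, hW', hB⟩ := exists_eq_sqrt_mul hJ B
  obtain ⟨U, hU, hU', hP⟩ := exists_polar hρ (B * Bᴴ)
  set s := CFC.sqrt (B * Bᴴ) with hs
  set P := CFC.sqrt (s * ρ * s) with hPdef
  have hrh : (CFC.sqrt ρ)ᴴ = CFC.sqrt ρ := conjTranspose_sqrt _
  -- `W` aligns the environment with that of `B`, and `U` cancels the polar phase of `√ρ √σ`,
  -- leaving the positive operator `P` in the overlap.
  refine ⟨CFC.sqrt ρ * U * J * W, ?_, ?_⟩
  · calc _ = CFC.sqrt ρ * (U * (J * (W * Wᴴ) * Jᴴ) * Uᴴ) * CFC.sqrt ρ := by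
          simp only [Matrix.conjTranspose_mul, hrh, Matrix.mul_assoc]
      _ = ρ := by
          rw [hW', Matrix.mul_one, hJ, Matrix.mul_one, hU', Matrix.mul_one, sqrt_mul_self_eq hρ]
  · change _ = (Matrix.trace P).re
    congr 1
    calc Matrix.trace ((CFC.sqrt ρ * U * J * W)ᴴ * B)
        = Matrix.trace (Wᴴ * (Jᴴ * (Uᴴ * (CFC.sqrt ρ * s)) * J * W)) := by
          conv_lhs => rw [hB]
          simp only [Matrix.conjTranspose_mul, hrh, Matrix.mul_assoc]
      _ = Matrix.trace (Jᴴ * (P * J)) := by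
          rw [Matrix.trace_mul_comm, Matrix.mul_assoc, hW', Matrix.mul_one, hP, ← Matrix.mul_assoc Uᴴ,
            hU, Matrix.one_mul, Matrix.mul_assoc]
      _ = Matrix.trace P := by
          rw [Matrix.trace_mul_comm, Matrix.mul_assoc, hJ, Matrix.mul_one]

/-- The coisometry associated with an injection of index types. -/
theorem exists_coisometry {ι κ : Type*} [Fintype κ] [DecidableEq ι] [DecidableEq κ]
    {f : ι → κ} (hf : f.Injective) : ∃ J : Matrix ι κ ℂ, J * Jᴴ = 1 := by
  refine ⟨(1 : Matrix κ κ ℂ).submatrix f id, ?_⟩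
  rw [Matrix.conjTranspose_submatrix, ← Matrix.submatrix_mul _ _ f id f Function.bijective_id]
  simp [Matrix.submatrix_one _ hf]

theorem buresDist_sq_le {ι κ : Type*} [Fintype ι] [DecidableEq ι] [Fintype κ] [DecidableEq κ]
    {ρ σ : Matrix ι ι ℂ} {τ υ : Matrix κ κ ℂ} (h : fidelity ρ σ ≤ fidelity τ υ) :
    buresDist τ υ ^ 2 ≤ buresDist ρ σ ^ 2 :=
  pow_le_pow_left₀ (Real.sqrt_nonneg _) (Real.sqrt_le_sqrt (by linarith)) 2

/-! ### Partial trace and fidelity -/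

/-- Move the ancilla from the row index to the column index. -/
def ancillaToColumn {α γ β κ : Type*} (A : Matrix ((α × γ) × β) κ ℂ) :
    Matrix (α × β) (γ × κ) ℂ :=
  Matrix.of fun x c => A ((x.1, c.1), x.2) c.2

section Ancilla

variable {α γ β κ : Type*} [Fintype α] [Fintype γ] [Fintype β] [Fintype κ]

omit [Fintype α] [Fintype β] in
-- The sum over columns on the right now includes the ancilla index, and this extra sum is the
-- partial trace.
theorem traceAncilla_mul_conjTranspose (A : Matrix ((α × γ) × β) κ ℂ) :
    traceAncilla (A * Aᴴ) = ancillaToColumn A * (ancillaToColumn A)ᴴ := by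
  ext x y
  simp only [traceAncilla, ancillaToColumn, Matrix.of_apply, Matrix.mul_apply,
    Matrix.conjTranspose_apply, Fintype.sum_prod_type]

theorem trace_ancillaToColumn (A B : Matrix ((α × γ) × β) κ ℂ) :
    Matrix.trace ((ancillaToColumn A)ᴴ * ancillaToColumn B) = Matrix.trace (Aᴴ * B) := by
  rw [Matrix.trace_mul_comm, Matrix.trace_mul_comm Aᴴ]
  simp only [ancillaToColumn, Matrix.of_apply, Matrix.mul_apply, Matrix.trace, Matrix.diag_apply,
    Matrix.conjTranspose_apply, Fintype.sum_prod_type]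
  refine Finset.sum_congr rfl fun a _ => ?_
  rw [Finset.sum_comm]

theorem trace_traceAncilla (τ : Matrix ((α × γ) × β) ((α × γ) × β) ℂ) :
    Matrix.trace (traceAncilla τ) = Matrix.trace τ := by
  simp only [traceAncilla, Matrix.of_apply, Matrix.trace, Matrix.diag_apply,
    Fintype.sum_prod_type]
  refine Finset.sum_congr rfl fun a _ => ?_
  rw [Finset.sum_comm]

variable [DecidableEq α] [DecidableEq γ] [DecidableEq β]

theorem exists_ancilla_coisometry [Nonempty γ] :
    ∃ J : Matrix (α × β) (γ × ((α × γ) × β)) ℂ, J * Jᴴ = 1 :=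
  let m : γ := Classical.arbitrary γ
  exists_coisometry (f := fun x : α × β => (m, ((x.1, m), x.2))) fun x y h => by
    simp only [Prod.mk.injEq] at h
    exact Prod.ext h.2.1.1 h.2.2

/-- The fidelity does not decrease under the partial trace. -/
theorem fidelity_le_traceAncilla [Nonempty γ] {τ σ : Matrix ((α × γ) × β) ((α × γ) × β) ℂ}
    (hτ : τ.PosSemidef) (hσ : σ.PosSemidef) :
    fidelity τ σ ≤ fidelity (traceAncilla τ) (traceAncilla σ) := by
  have hB : CFC.sqrt σ * (CFC.sqrt σ)ᴴ = σ := by rw [conjTranspose_sqrt, sqrt_mul_self_eq hσ]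
  -- An environment of the same size as the system already suffices, so the coisometry can be the
  -- identity.
  obtain ⟨A, hA, hF⟩ := exists_purification (J := 1) (by simp) hτ (CFC.sqrt σ)
  obtain ⟨J, hJ⟩ := exists_ancilla_coisometry (α := α) (γ := γ) (β := β)
  rw [hB] at hF
  rw [← hF, ← trace_ancillaToColumn]
  refine (re_trace_le_fidelity hJ _ _).trans_eq ?_
  rw [← traceAncilla_mul_conjTranspose, ← traceAncilla_mul_conjTranspose, hA, hB]

/-- Given an extension `σ` of some state, every state has an extension that is at least as close
to `σ` as the original states were. -/
theorem exists_isExtension [Nonempty γ] {ρ : Matrix (α × β) (α × β) ℂ} (hρ : IsDensity ρ)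
    {σ : Matrix ((α × γ) × β) ((α × γ) × β) ℂ} (hσ : σ.PosSemidef) :
    ∃ τ : Matrix ((α × γ) × β) ((α × γ) × β) ℂ, IsExtension ρ τ ∧
      fidelity ρ (traceAncilla σ) ≤ fidelity τ σ := by
  have hB : CFC.sqrt σ * (CFC.sqrt σ)ᴴ = σ := by rw [conjTranspose_sqrt, sqrt_mul_self_eq hσ]
  obtain ⟨J, hJ⟩ := exists_ancilla_coisometry (α := α) (γ := γ) (β := β)
  obtain ⟨A, hA, hF⟩ := exists_purification hJ hρ.1 (ancillaToColumn (CFC.sqrt σ))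
  -- The ancilla is moved back from the environment to the system, which inverts `ancillaToColumn`.
  let C : Matrix ((α × γ) × β) ((α × γ) × β) ℂ :=
    Matrix.of fun x c => A (x.1.1, x.2) (x.1.2, c)
  have hC : ancillaToColumn C = A := rfl
  have htr : traceAncilla (C * Cᴴ) = ρ := by rw [traceAncilla_mul_conjTranspose, hC, hA]
  refine ⟨C * Cᴴ, ⟨⟨Matrix.posSemidef_self_mul_conjTranspose C, ?_⟩, htr⟩, ?_⟩
  · rw [← trace_traceAncilla, htr, hρ.2]
  · rw [← traceAncilla_mul_conjTranspose, hB, ← hC, trace_ancillaToColumn] at hF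
    rw [← hF]
    refine (re_trace_le_fidelity (J := 1) (by simp) _ _).trans_eq ?_
    rw [hB]

end Ancilla

/-! ### Separable and classical-quantum states -/

theorem ketbra_posSemidef {ι : Type*} [Finite ι] (v : EuclideanSpace ℂ ι) :
    (ketbra v).PosSemidef :=
  Matrix.posSemidef_vecMulVec_self_star v.ofLp

theorem isDensity_ketbra {ι : Type*} [Fintype ι] {v : EuclideanSpace ℂ ι} (hv : ‖v‖ = 1) :
    IsDensity (ketbra v) := by
  refine ⟨ketbra_posSemidef v, ?_⟩
  have h := EuclideanSpace.norm_sq_eq v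
  rw [hv] at h
  simp only [Matrix.trace, ketbra, Matrix.diag_apply, Matrix.of_apply, RCLike.star_def,
    Complex.mul_conj']
  rw [one_pow] at h
  exact_mod_cast h.symm

/-- A density matrix is a convex combination of pure states. -/
theorem IsDensity.exists_eq_sum_ketbra {ι : Type*} [Fintype ι] [DecidableEq ι] {ρ : Matrix ι ι ℂ}
    (hρ : IsDensity ρ) :
    ∃ (l : ι → ℝ) (u : ι → EuclideanSpace ℂ ι), (∀ x, 0 ≤ l x) ∧ ∑ x, l x = 1 ∧
      (∀ x, ‖u x‖ = 1) ∧ ρ = ∑ x, (l x : ℂ) • ketbra (u x) := by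
  have hH := hρ.1.isHermitian
  refine ⟨hH.eigenvalues, hH.eigenvectorBasis, hρ.1.eigenvalues_nonneg, ?_,
    hH.eigenvectorBasis.orthonormal.1, ?_⟩
  · have h := hH.trace_eq_sum_eigenvalues
    rw [hρ.2] at h
    apply Complex.ofReal_injective
    rw [Complex.ofReal_sum, Complex.ofReal_one]
    exact h.symm
  · conv_lhs => rw [hH.spectral_theorem]
    ext i j
    rw [Unitary.conjStarAlgAut_apply, Matrix.mul_apply, Matrix.sum_apply]
    refine Finset.sum_congr rfl fun x _ => ?_
    rw [Matrix.mul_diagonal]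
    simp [ketbra, Matrix.star_apply]
    ring

/-- Vectors tagged by distinct basis vectors of an ancilla. -/
def taggedVec {α γ : Type*} [DecidableEq γ] (u : EuclideanSpace ℂ α) (m : γ) :
    EuclideanSpace ℂ (α × γ) :=
  WithLp.toLp 2 fun y => if y.2 = m then u y.1 else 0

/-- Distinct tags have disjoint supports, so orthogonality needs no relation between the `u m`. -/
theorem orthonormal_taggedVec {α γ : Type*} [Fintype α] [Fintype γ] [DecidableEq γ]
    {u : γ → EuclideanSpace ℂ α} (hu : ∀ m, ‖u m‖ = 1) :
    Orthonormal ℂ fun m => taggedVec (u m) m := by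
  rw [orthonormal_iff_ite]
  intro i j
  have : inner ℂ (taggedVec (u i) i) (taggedVec (u j) j) =
      if i = j then inner ℂ (u i) (u j) else 0 := by
    simp only [PiLp.inner_apply, taggedVec, Fintype.sum_prod_type]
    split_ifs with h
    · subst h
      refine Finset.sum_congr rfl fun a _ => ?_
      rw [Finset.sum_eq_single i (fun m _ hm => by simp [hm]) (by simp)]
      simp
    · refine Finset.sum_eq_zero fun a _ => Finset.sum_eq_zero fun m _ => ?_
      by_cases hm : m = i
      · have : m ≠ j := fun h' => h (hm.symm.trans h')
        simp [this]
      · simp [hm]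
  rw [this]
  split_ifs with h
  · subst h
    rw [inner_self_eq_norm_sq_to_K, hu]; simp
  · rfl

section CQ

variable {α γ β : Type*} [Fintype α] [Fintype γ] [Fintype β]

omit [Fintype α] [Fintype β] in
theorem traceAncilla_sum_kronecker {k : Type*} [Fintype k] (c : k → ℂ)
    (M : k → Matrix (α × γ) (α × γ) ℂ) (N : k → Matrix β β ℂ) :
    traceAncilla (∑ i, c i • (M i ⊗ₖ N i)) =
      ∑ i, c i • ((Matrix.of fun x y => ∑ m, M i (x, m) (y, m)) ⊗ₖ N i) := by
  ext x y
  simp only [traceAncilla, Matrix.of_apply, Matrix.sum_apply, Matrix.smul_apply,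
    Matrix.kroneckerMap_apply, smul_eq_mul]
  rw [Finset.sum_comm]
  simp only [Finset.sum_mul, Finset.mul_sum]

theorem isDensity_partialTrace_ketbra {e : EuclideanSpace ℂ (α × γ)} (he : ‖e‖ = 1) :
    IsDensity (Matrix.of fun x y => ∑ m, ketbra e (x, m) (y, m)) := by
  -- Slicing `e` along the ancilla exhibits the partial trace as a sum of rank-one operators.
  have h : (Matrix.of fun x y => ∑ m, ketbra e (x, m) (y, m)) =
      ∑ m, ketbra (WithLp.toLp 2 fun x => e (x, m) : EuclideanSpace ℂ α) := by
    ext x y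
    simp [Matrix.sum_apply, ketbra]
  constructor
  · rw [h]
    exact Matrix.posSemidef_sum _ fun m _ => ketbra_posSemidef _
  · rw [← (isDensity_ketbra he).2]
    simp [Matrix.trace, Fintype.sum_prod_type]

theorem traceAncilla_mem_separable {σ : Matrix ((α × γ) × β) ((α × γ) × β) ℂ}
    (hσ : σ ∈ classicalQuantum (α × γ) β) : traceAncilla σ ∈ separable α β := by
  obtain ⟨k, p, e, ρb, hp, hp1, he, hb, rfl⟩ := hσ
  exact ⟨k, p, _, ρb, hp, hp1, fun i => isDensity_partialTrace_ketbra (he.1 i), hb,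
    traceAncilla_sum_kronecker _ _ _⟩

theorem classicalQuantum_subset_separable : classicalQuantum α β ⊆ separable α β := by
  rintro _ ⟨k, p, e, ρb, hp, hp1, he, hb, rfl⟩
  exact ⟨k, p, _, ρb, hp, hp1, fun i => isDensity_ketbra (he.1 i), hb, rfl⟩

theorem classicalQuantum_nonempty [Nonempty α] [Nonempty β] :
    (classicalQuantum α β).Nonempty := by
  classical
  let a : α := Classical.arbitrary α
  let b : β := Classical.arbitrary β
  refine ⟨_, 1, fun _ => 1, fun _ => EuclideanSpace.single a 1,
    fun _ => ketbra (EuclideanSpace.single b 1), fun _ => zero_le_one, by simp, ?_,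
    fun _ => isDensity_ketbra (by simp), rfl⟩
  rw [orthonormal_iff_ite]
  intro i j
  simp [Subsingleton.elim i j]

theorem posSemidef_of_mem_separable [DecidableEq α] [DecidableEq β] {σ : Matrix (α × β) (α × β) ℂ}
    (hσ : σ ∈ separable α β) : σ.PosSemidef := by
  obtain ⟨k, p, ρa, ρb, hp, -, ha, hb, rfl⟩ := hσ
  refine Matrix.posSemidef_sum _ fun i _ => ?_
  exact ((ha i).1.kronecker (hb i).1).smul (by exact_mod_cast hp i)

/-- Every separable state has a classical-quantum extension by an ancilla on the first side. -/
theorem exists_classicalQuantum_extension [DecidableEq α] {σ : Matrix (α × β) (α × β) ℂ}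
    (hσ : σ ∈ separable α β) :
    ∃ (n : ℕ) (υ : Matrix ((α × Fin n) × β) ((α × Fin n) × β) ℂ), Nonempty (Fin n) ∧
      υ ∈ classicalQuantum (α × Fin n) β ∧ traceAncilla υ = σ := by
  obtain ⟨k, p, ρa, ρb, hp, hp1, ha, hb, rfl⟩ := hσ
  choose l u hl hl1 hu hρ using fun i => (ha i).exists_eq_sum_ketbra
  -- One ancilla level for each pair of a term of the mixture and an eigenvector of its first
  -- factor.
  let φ : Fin (Fintype.card (Fin k × α)) ≃ Fin k × α := (Fintype.equivFin _).symm
  have hsum : ∑ j, p (φ j).1 * l (φ j).1 (φ j).2 = 1 := by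
    rw [φ.sum_comp (fun x => p x.1 * l x.1 x.2), Fintype.sum_prod_type]
    simp only [← Finset.mul_sum, hl1, mul_one, hp1]
  refine ⟨_, _, ?_, ⟨_, fun j => p (φ j).1 * l (φ j).1 (φ j).2,
    fun j => taggedVec (u (φ j).1 (φ j).2) j, fun j => ρb (φ j).1,
    fun j => mul_nonneg (hp _) (hl _ _), hsum, orthonormal_taggedVec fun j => hu _ _,
    fun j => hb _, rfl⟩, ?_⟩
  · by_contra h
    rw [not_nonempty_iff] at h
    rw [Finset.univ_eq_empty, Finset.sum_empty] at hsum
    exact zero_ne_one hsum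
  · rw [traceAncilla_sum_kronecker]
    have h1 : ∀ j, (Matrix.of fun x y => ∑ m, ketbra (taggedVec (u (φ j).1 (φ j).2) j) (x, m) (y, m))
        = ketbra (u (φ j).1 (φ j).2) := by
      intro j
      ext x y
      simp only [Matrix.of_apply, ketbra, taggedVec]
      rw [Finset.sum_eq_single j (fun m _ hm => by simp [hm]) (by simp)]
      simp
    simp only [h1]
    rw [φ.sum_comp (fun x => ((p x.1 * l x.1 x.2 : ℝ) : ℂ) • (ketbra (u x.1 x.2) ⊗ₖ ρb x.1)),
      Fintype.sum_prod_type]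
    refine Finset.sum_congr rfl fun i _ => ?_
    conv_rhs => rw [hρ i]
    ext x y
    simp only [Matrix.sum_apply, Matrix.smul_apply, Matrix.kroneckerMap_apply, smul_eq_mul,
      Finset.sum_mul, Finset.mul_sum, Complex.ofReal_mul, mul_assoc]

end CQ

/-! ### Continuity of the Bures distance and compactness -/

section
open scoped Matrix.Norms.L2Operator

theorem continuousOn_sqrt {ι : Type*} [Fintype ι] [DecidableEq ι] :
    ContinuousOn (CFC.sqrt : Matrix ι ι ℂ → Matrix ι ι ℂ) {σ | σ.PosSemidef} := by
  have := CFC.continuousOn_sqrt (A := Matrix ι ι ℂ)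
  simpa only [Matrix.nonneg_iff_posSemidef] using this
end

theorem continuousOn_buresDist_sq {ι : Type*} [Fintype ι] [DecidableEq ι] {ρ : Matrix ι ι ℂ}
    (hρ : ρ.PosSemidef) :
    ContinuousOn (fun σ => buresDist ρ σ ^ 2) {σ | σ.PosSemidef} := by
  have hs := continuousOn_sqrt (ι := ι)
  have h1 : ContinuousOn (fun σ => CFC.sqrt σ * ρ * CFC.sqrt σ) {σ | σ.PosSemidef} :=
    (hs.mul continuousOn_const).mul hs
  have h2 : ContinuousOn (fun σ => CFC.sqrt (CFC.sqrt σ * ρ * CFC.sqrt σ))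
      {σ : Matrix ι ι ℂ | σ.PosSemidef} := hs.comp h1 fun σ _ => by
    have := hρ.conjTranspose_mul_mul_same (CFC.sqrt σ)
    rwa [conjTranspose_sqrt] at this
  have h3 : ContinuousOn (fun σ => fidelity ρ σ) {σ | σ.PosSemidef} :=
    Complex.continuous_re.comp_continuousOn (continuous_id.matrix_trace.comp_continuousOn h2)
  exact (Real.continuous_sqrt.comp_continuousOn
    (continuousOn_const.sub (continuousOn_const.mul h3))).pow 2

theorem isLeast_sqBuresValues {ι : Type*} [Fintype ι] [DecidableEq ι] {ρ : Matrix ι ι ℂ}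
    (hρ : ρ.PosSemidef) {S : Set (Matrix ι ι ℂ)} (hS : IsCompact S) (hne : S.Nonempty)
    (hpos : ∀ σ ∈ S, σ.PosSemidef) :
    IsLeast (sqBuresValues ρ S) (sInf (sqBuresValues ρ S)) := by
  have h : sqBuresValues ρ S = (fun σ => buresDist ρ σ ^ 2) '' S := by
    ext x
    exact ⟨fun ⟨σ, h, e⟩ => ⟨σ, h, e.symm⟩, fun ⟨σ, h, e⟩ => ⟨σ, h, e.symm⟩⟩
  rw [h]
  exact (hS.image_of_continuousOn ((continuousOn_buresDist_sq hρ).mono hpos)).isLeast_sInf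
    (hne.image _)

/-- The density matrices are the image of the Hilbert–Schmidt unit sphere under `A ↦ A * Aᴴ`, with
`√ρ` as a preimage of `ρ`. -/
theorem isCompact_isDensity (ι : Type*) [Fintype ι] :
    IsCompact {ρ : Matrix ι ι ℂ | IsDensity ρ} := by
  classical
  have hK : IsCompact {A : Matrix ι ι ℂ | Matrix.trace (A * Aᴴ) = 1} := by
    have hbox : IsCompact (Set.univ.pi fun _ : ι => Set.univ.pi fun _ : ι =>
        Metric.closedBall (0 : ℂ) 1) :=
      isCompact_univ_pi fun _ => isCompact_univ_pi fun _ => isCompact_closedBall _ _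
    refine IsCompact.of_isClosed_subset (X := Matrix ι ι ℂ) hbox ?_ ?_
    · exact isClosed_eq (by fun_prop) continuous_const
    · intro A hA i _ j _
      have h1 : ∑ i, ∑ j, ‖A i j‖ ^ 2 = (1 : ℝ) := by
        have hA' : Matrix.trace (A * Aᴴ) = 1 := hA
        simp only [Matrix.trace, Matrix.diag_apply, Matrix.mul_apply, Matrix.conjTranspose_apply,
          RCLike.star_def, Complex.mul_conj'] at hA'
        exact_mod_cast hA'
      have h2 : ‖A i j‖ ^ 2 ≤ 1 := by
        rw [← h1]
        refine le_trans ?_ (Finset.single_le_sum (f := fun i => ∑ j, ‖A i j‖ ^ 2)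
          (fun i _ => Finset.sum_nonneg fun j _ => sq_nonneg _) (Finset.mem_univ i))
        exact Finset.single_le_sum (f := fun j => ‖A i j‖ ^ 2)
          (fun j _ => sq_nonneg _) (Finset.mem_univ j)
      rw [mem_closedBall_zero_iff]
      exact (sq_le_one_iff₀ (norm_nonneg _)).1 h2
  have himg : {ρ : Matrix ι ι ℂ | IsDensity ρ} =
      (fun A : Matrix ι ι ℂ => A * Aᴴ) '' {A | Matrix.trace (A * Aᴴ) = 1} := by
    ext ρ
    constructor
    · intro h
      have e : CFC.sqrt ρ * (CFC.sqrt ρ)ᴴ = ρ := by rw [conjTranspose_sqrt, sqrt_mul_self_eq h.1]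
      exact ⟨CFC.sqrt ρ, by rw [Set.mem_ofPred_eq, e, h.2], e⟩
    · rintro ⟨A, hA, rfl⟩
      exact ⟨Matrix.posSemidef_self_mul_conjTranspose A, hA⟩
  rw [himg]
  exact hK.image (by fun_prop)

/-- A mixture of product operators depends continuously on the weights and on the factors. -/
theorem continuous_sum_smul_kronecker {X k α β : Type*} [TopologicalSpace X] [Fintype k]
    {p : X → k → ℝ} {a : X → k → Matrix α α ℂ} {b : X → k → Matrix β β ℂ}
    (hp : Continuous p) (ha : ∀ i, Continuous fun x => a x i) (hb : Continuous b) :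
    Continuous fun x => ∑ i, (p x i : ℂ) • (a x i ⊗ₖ b x i) := by
  refine continuous_finsetSum _ fun i _ => ?_
  refine (Complex.continuous_ofReal.comp ((continuous_apply i).comp hp)).smul ?_
  exact continuous_matrix fun _ _ => ((ha i).matrix_elem _ _).mul
    (((continuous_apply i).comp hb).matrix_elem _ _)

theorem continuous_ketbra {ι : Type*} : Continuous (ketbra : EuclideanSpace ℂ ι → Matrix ι ι ℂ) :=
  continuous_matrix fun _ _ => by
    simp only [ketbra, Matrix.of_apply]
    fun_prop

/-- Orthonormal families have at most `Fintype.card α` members, so finitely many compact parameter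
spaces cover the set. -/
theorem isCompact_classicalQuantum (α β : Type*) [Fintype α] [Fintype β] :
    IsCompact (classicalQuantum α β) := by
  have hsphere : ∀ k : ℕ, IsCompact {e : Fin k → EuclideanSpace ℂ α | Orthonormal ℂ e} := by
    intro k
    refine IsCompact.of_isClosed_subset
      (isCompact_univ_pi fun _ : Fin k => isCompact_closedBall (0 : EuclideanSpace ℂ α) 1) ?_ ?_
    · simp only [orthonormal_iff_ite, Set.ofPred_forall]
      exact isClosed_iInter fun i => isClosed_iInter fun j =>
        isClosed_eq ((continuous_apply i).inner (continuous_apply j)) continuous_const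
    · intro e he i _
      simp [he.1 i]
  have key : classicalQuantum α β = ⋃ k ∈ Finset.range (Fintype.card α + 1),
      (fun x : (Fin k → ℝ) × (Fin k → EuclideanSpace ℂ α) × (Fin k → Matrix β β ℂ) =>
        ∑ i, (x.1 i : ℂ) • (ketbra (x.2.1 i) ⊗ₖ x.2.2 i)) ''
        (stdSimplex ℝ (Fin k) ×ˢ {e | Orthonormal ℂ e} ×ˢ
          Set.univ.pi fun _ => {ρ | IsDensity ρ}) := by
    ext σ
    simp only [Set.mem_iUnion]
    constructor
    · rintro ⟨k, p, e, ρb, hp, hp1, he, hb, rfl⟩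
      have hk := he.linearIndependent.fintype_card_le_finrank
      simp only [Fintype.card_fin, finrank_euclideanSpace] at hk
      exact ⟨k, Finset.mem_range.2 (Nat.lt_succ_of_le hk), (p, e, ρb),
        ⟨⟨hp, hp1⟩, he, fun i _ => hb i⟩, rfl⟩
    · rintro ⟨k, -, ⟨p, e, ρb⟩, ⟨⟨hp, hp1⟩, he, hb⟩, rfl⟩
      exact ⟨k, p, e, ρb, hp, hp1, he, fun i => hb i (Set.mem_univ i), rfl⟩
  rw [key]
  refine Finset.isCompact_biUnion _ fun k _ => ?_
  refine ((isCompact_stdSimplex ℝ (Fin k)).prod ((hsphere k).prod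
    (isCompact_univ_pi fun _ => isCompact_isDensity β))).image ?_
  exact continuous_sum_smul_kronecker continuous_fst
    (fun i => continuous_ketbra.comp ((continuous_apply i).comp continuous_snd.fst))
    continuous_snd.snd

/-- The number of terms is unbounded in the definition; Carathéodory's theorem bounds it by the real
dimension plus one, and `Finset.range` excludes its endpoint, hence the `+ 2`. -/
theorem isCompact_separable (α β : Type*) [Fintype α] [Fintype β] :
    IsCompact (separable α β) := by
  have key : separable α β =
      ⋃ k ∈ Finset.range (Module.finrank ℝ (Matrix (α × β) (α × β) ℂ) + 2),
      (fun x : (Fin k → ℝ) × (Fin k → Matrix α α ℂ) × (Fin k → Matrix β β ℂ) =>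
        ∑ i, (x.1 i : ℂ) • (x.2.1 i ⊗ₖ x.2.2 i)) ''
        (stdSimplex ℝ (Fin k) ×ˢ (Set.univ.pi fun _ => {ρ | IsDensity ρ}) ×ˢ
          Set.univ.pi fun _ => {ρ | IsDensity ρ}) := by
    ext σ
    simp only [Set.mem_iUnion]
    constructor
    · rintro ⟨k, p, ρa, ρb, hp, hp1, ha, hb, rfl⟩
      have hmem : ∑ i, (p i : ℂ) • (ρa i ⊗ₖ ρb i) ∈ convexHull ℝ
          {σ : Matrix (α × β) (α × β) ℂ | ∃ a b, IsDensity a ∧ IsDensity b ∧ a ⊗ₖ b = σ} := by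
        simp only [Complex.coe_smul]
        exact (convex_convexHull ℝ _).sum_mem (fun i _ => hp i) hp1 fun i _ =>
          subset_convexHull ℝ _ ⟨_, _, ha i, hb i, rfl⟩
      obtain ⟨ι, _, z, w, hz, hind, hw, hw1, hsum⟩ := eq_pos_convex_span_of_mem_convexHull hmem
      have hcard : Fintype.card ι ≤ Module.finrank ℝ (Matrix (α × β) (α × β) ℂ) + 1 :=
        hind.card_le_finrank_succ.trans (Nat.succ_le_succ (Submodule.finrank_le _))
      choose a b ha' hb' hab using fun i => hz (Set.mem_range_self i)
      let φ := (Fintype.equivFin ι).symm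
      refine ⟨Fintype.card ι, Finset.mem_range.2 (by omega),
        (fun j => w (φ j), fun j => a (φ j), fun j => b (φ j)),
        ⟨⟨fun j => (hw _).le, ?_⟩, fun j _ => ha' _, fun j _ => hb' _⟩, ?_⟩
      · rw [φ.sum_comp w, hw1]
      · simp only [Complex.coe_smul, hab]
        simp only [φ.sum_comp (fun i => w i • z i), hsum, Complex.coe_smul]
    · rintro ⟨k, -, ⟨p, a, b⟩, ⟨⟨hp, hp1⟩, ha, hb⟩, rfl⟩
      exact ⟨k, p, a, b, hp, hp1, fun i => ha i (Set.mem_univ i), fun i => hb i (Set.mem_univ i),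
        rfl⟩
  rw [key]
  refine Finset.isCompact_biUnion _ fun k _ => ?_
  refine ((isCompact_stdSimplex ℝ (Fin k)).prod
    ((isCompact_univ_pi fun _ => isCompact_isDensity α).prod
    (isCompact_univ_pi fun _ => isCompact_isDensity β))).image ?_
  exact continuous_sum_smul_kronecker continuous_fst
    (fun i => (continuous_apply i).comp continuous_snd.fst)
    continuous_snd.snd

end QState

/-! ### The two inequalities and attainment -/

theorem theorem4 {α β : Type*} [Fintype α] [Fintype β] [DecidableEq α] [DecidableEq β]
    (ρ : Matrix (α × β) (α × β) ℂ) (hρ : QState.IsDensity ρ) :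
    IsLeast (QState.sqBuresValues ρ (QState.separable α β)) (QState.buresEntanglement ρ) ∧
    (∀ (n : ℕ) (τ : Matrix ((α × Fin n) × β) ((α × Fin n) × β) ℂ), QState.IsExtension ρ τ →
      IsLeast (QState.sqBuresValues τ (QState.classicalQuantum (α × Fin n) β))
        (QState.buresDiscord τ)) ∧
    IsLeast (QState.extensionDiscordValues ρ) (QState.minExtensionDiscord ρ) ∧
    QState.minExtensionDiscord ρ = QState.buresEntanglement ρ := by
  -- Unit trace excludes an empty index type; in particular an extension forces `n ≠ 0`.
  have hne : ∀ {ι : Type _} [Fintype ι] {τ : Matrix ι ι ℂ}, QState.IsDensity τ → Nonempty ι := by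
    intro ι _ τ hτ
    by_contra h
    rw [not_nonempty_iff] at h
    have := hτ.2
    rw [Matrix.trace, Finset.univ_eq_empty, Finset.sum_empty] at this
    exact zero_ne_one this
  obtain ⟨a, b⟩ := (hne hρ).some
  have : Nonempty α := ⟨a⟩
  have : Nonempty β := ⟨b⟩
  have hE : IsLeast (QState.sqBuresValues ρ (QState.separable α β))
      (QState.buresEntanglement ρ) :=
    QState.isLeast_sqBuresValues hρ.1 (QState.isCompact_separable α β)
      (QState.classicalQuantum_nonempty.mono QState.classicalQuantum_subset_separable)
      fun _ => QState.posSemidef_of_mem_separable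
  have hpos : ∀ (n : ℕ), ∀ υ ∈ QState.classicalQuantum (α × Fin n) β, υ.PosSemidef := fun n υ hυ =>
    QState.posSemidef_of_mem_separable (QState.classicalQuantum_subset_separable hυ)
  have hD : ∀ (n : ℕ) (τ : Matrix ((α × Fin n) × β) ((α × Fin n) × β) ℂ),
      QState.IsExtension ρ τ → IsLeast
        (QState.sqBuresValues τ (QState.classicalQuantum (α × Fin n) β))
        (QState.buresDiscord τ) := by
    intro n τ hτ
    have : Nonempty (α × Fin n) := (hne hτ.1).map Prod.fst
    exact QState.isLeast_sqBuresValues hτ.1.1 (QState.isCompact_classicalQuantum _ _)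
      QState.classicalQuantum_nonempty (hpos n)
  have hlower : ∀ (n : ℕ) (τ : Matrix ((α × Fin n) × β) ((α × Fin n) × β) ℂ),
      QState.IsExtension ρ τ → QState.buresEntanglement ρ ≤ QState.buresDiscord τ := by
    intro n τ hτ
    have : Nonempty (Fin n) := (hne hτ.1).map fun x => x.1.2
    obtain ⟨υ, hυ, h⟩ := (hD n τ hτ).1
    have hF := QState.fidelity_le_traceAncilla hτ.1.1 (hpos n υ hυ)
    rw [hτ.2] at hF
    rw [h]
    exact (hE.2 ⟨_, QState.traceAncilla_mem_separable hυ, rfl⟩).trans (QState.buresDist_sq_le hF)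
  have hL : IsLeast (QState.extensionDiscordValues ρ) (QState.buresEntanglement ρ) := by
    constructor
    · obtain ⟨σ, hσ, h⟩ := hE.1
      obtain ⟨n, υ, hn, hυ, rfl⟩ := QState.exists_classicalQuantum_extension hσ
      obtain ⟨τ, hτ, hF⟩ := QState.exists_isExtension hρ (hpos n υ hυ)
      -- The discord of `τ` is at most its distance to `υ`, hence at most that of `ρ` to its closest
      -- separable state; `hlower` turns this into equality.
      refine ⟨n, τ, hτ, (hlower n τ hτ).antisymm ?_⟩
      rw [h]
      exact ((hD n τ hτ).2 ⟨υ, hυ, rfl⟩).trans (QState.buresDist_sq_le hF)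
    · rintro x ⟨n, τ, hτ, rfl⟩
      exact hlower n τ hτ
  have heq : QState.minExtensionDiscord ρ = QState.buresEntanglement ρ := hL.csInf_eq
  exact ⟨hE, hD, heq ▸ hL, heq⟩
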